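/- Let $m\ge 0$ and $d\ge 1$ be integers, $[m]=\{1,\dots,m\}$, and let $\mu:2^{[m]}\to\mathbb{R}_{\ge 0}$ be a probability distribution on the subsets of $[m]$, i.e. $\sum_{S\subseteq[m]}\mu(S)=1$. Let $g_\mu(z_1,\dots,z_m)=\sum_{S\subseteq[m]}\mu(S)\prod_{i\in S}z_i$ be its generating polynomial. Assume that $\mu$ is homogeneous, i.e. $g_\mu$ is a homogeneous polynomial, and strongly Rayleigh, i.e. $g_\mu$ is real stable: $g_\mu(z)\ne 0$ for all $z\in\mathbb{C}^m$ with $\operatorname{Im} z_i>0$ for every $i$. Let $v_1,\dots,v_m\in\mathbb{R}^d$ be arbitrary vectors and let $\mathcal F=\{S\subseteq[m]:\mu(S)>0\}$. For $S\in\mathcal F$ put $$q_S(x)=\mu(S)\cdot\chi\Big[\sum_{i\in S}2v_iv_i^{\mathsf T}\Big](x^2),\qquad \chi[M](x)=\det(xI-M).$$ Then the polynomials $\{q_S\}_{S\in\mathcal F}$ form an interlacing family. That is: 1. $\mathcal F$ is nonempty, and the polynomials $q_S$, $S\in\mathcal F$, are real rooted, all of the same degree, and have positive leading coefficients. 2.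 For $s_1,\dots,s_k\in\{0,1\}$ let $\mathcal F_{s_1,\dots,s_k}=\{S\in\mathcal F:\ i\in S\Leftrightarrow s_i=1\text{ for all }1\le i\le k\}$ and $q_{s_1,\dots,s_k}=\sum_{S\in\mathcal F_{s_1,\dots,s_k}}q_S$. For all $0\le k<m$ and all $s_1,\dots,s_k\in\{0,1\}$ such that $\mathcal F_{s_1,\dots,s_k,0}$ and $\mathcal F_{s_1,\dots,s_k,1}$ are both nonempty, the polynomials $q_{s_1,\dots,s_k,0}$ and $q_{s_1,\dots,s_k,1}$ have a common interlacing, i.e. there is one polynomial $g$ that interlaces both of them. Here a polynomial $g(x)=\alpha_0\prod_{i=1}^{n-1}(x-\alpha_i)$ interlaces a polynomial $f(x)=\beta_0\prod_{i=1}^{n}(x-\beta_i)$, where $n\ge 1$, all $\alpha_i,\beta_i$ are real and $\alpha_0,\beta_0\neq 0$, if $\beta_1\le\alpha_1\le\beta_2\le\alpha_2\le\dots\le\alpha_{n-1}\le\beta_n$. -/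

import Mathlib

open Polynomial

noncomputable section

namespace StronglyRayleigh

/-! ### Stable polynomials -/

/-- A complex polynomial is stable if it has no zero all of whose coordinates lie in the open
upper half-plane. -/
def IsStable {σ : Type*} (p : MvPolynomial σ ℂ) : Prop :=
  ∀ z : σ → ℂ, (∀ i, 0 < (z i).im) → MvPolynomial.eval z p ≠ 0

/-- A polynomial with real coefficients is real stable if it is stable as a complex polynomial. -/
def IsRealStable {σ : Type*} (p : MvPolynomial σ ℝ) : Prop :=
  IsStable (MvPolynomial.map (algebraMap ℝ ℂ) p)

/-! ### Probability distributions on the subsets of `[m] = Fin m` -/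

/-- `μ` is a probability distribution on the subsets of `[m]`. -/
def IsProbDist {m : ℕ} (μ : Finset (Fin m) → ℝ) : Prop :=
  (∀ S, 0 ≤ μ S) ∧ ∑ S, μ S = 1

/-- The generating polynomial `∑ S, μ(S) * ∏ i ∈ S, z i`. -/
def genPoly {m : ℕ} (μ : Finset (Fin m) → ℝ) : MvPolynomial (Fin m) ℝ :=
  ∑ S, MvPolynomial.C (μ S) * ∏ i ∈ S, MvPolynomial.X i

/-- `μ` is homogeneous if its generating polynomial is homogeneous (of some degree). -/
def IsHomogeneous {m : ℕ} (μ : Finset (Fin m) → ℝ) : Prop :=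
  ∃ n : ℕ, (genPoly μ).IsHomogeneous n

/-- `μ` is strongly Rayleigh if its generating polynomial is real stable. -/
def IsStronglyRayleigh {m : ℕ} (μ : Finset (Fin m) → ℝ) : Prop :=
  IsRealStable (genPoly μ)

/-- The support `{S : μ(S) > 0}`. -/
def support {m : ℕ} (μ : Finset (Fin m) → ℝ) : Finset (Finset (Fin m)) :=
  Finset.univ.filter fun S => 0 < μ S

/-! ### Interlacing families -/

/-- A real polynomial is real rooted if it is nonzero and is a product of a constant and linear
factors over `ℝ`. -/
def IsRealRooted (f : ℝ[X]) : Prop := f ≠ 0 ∧ f.Splits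

/-- `g` interlaces `f`: `g = a ∏ (x - α i)` and `f = b ∏ (x - β i)` with `a, b ≠ 0`, where `f` has
one root more than `g`, and `β 0 ≤ α 0 ≤ β 1 ≤ α 1 ≤ ⋯ ≤ α (n - 1) ≤ β n`. -/
def Interlaces (g f : ℝ[X]) : Prop :=
  ∃ (n : ℕ) (a b : ℝ) (α : Fin n → ℝ) (β : Fin (n + 1) → ℝ),
    a ≠ 0 ∧ b ≠ 0 ∧
    g = C a * ∏ i, (X - C (α i)) ∧
    f = C b * ∏ i, (X - C (β i)) ∧
    ∀ i : Fin n, β i.castSucc ≤ α i ∧ α i ≤ β i.succ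

/-- The polynomials `f i` have a common interlacing: a single `g` interlaces all of them. -/
def HaveCommonInterlacing {ι : Type*} (f : ι → ℝ[X]) : Prop :=
  ∃ g : ℝ[X], ∀ i, Interlaces g (f i)

/-- `F_{s_1,…,s_k}`: the members of `F` whose membership pattern on the first `k` elements of `[m]`
is `s`. -/
def restrict {m : ℕ} (F : Finset (Finset (Fin m))) {k : ℕ} (s : Fin k → Bool) :
    Finset (Finset (Fin m)) :=
  F.filter fun S => ∀ (i : Fin m) (h : i.val < k), i ∈ S ↔ s ⟨i.val, h⟩ = true

/-- `f_{s_1,…,s_k}`: the sum of `f S` over `S ∈ F_{s_1,…,s_k}`. -/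
def partialSum {m : ℕ} (F : Finset (Finset (Fin m))) (f : Finset (Fin m) → ℝ[X])
    {k : ℕ} (s : Fin k → Bool) : ℝ[X] :=
  ∑ S ∈ restrict F s, f S

/-- `(s_1,…,s_k,b)`. -/
def extend {k : ℕ} (s : Fin k → Bool) (b : Bool) : Fin (k + 1) → Bool :=
  Fin.snoc (α := fun _ => Bool) s b

/-- The polynomials `f S`, `S ∈ F`, form an interlacing family: `F` is nonempty, the `f S` are real
rooted of one common degree with positive leading coefficients, and for all `0 ≤ k < m` and all
`s_1,…,s_k`, if `F_{s_1,…,s_k,0}` and `F_{s_1,…,s_k,1}` are both nonempty, then `f_{s_1,…,s_k,0}`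
and `f_{s_1,…,s_k,1}` have a common interlacing. -/
def IsInterlacingFamily {m : ℕ} (F : Finset (Finset (Fin m))) (f : Finset (Fin m) → ℝ[X]) :
    Prop :=
  F.Nonempty ∧
  (∃ D : ℕ, ∀ S ∈ F, IsRealRooted (f S) ∧ (f S).natDegree = D ∧ 0 < (f S).leadingCoeff) ∧
  ∀ k : ℕ, k < m → ∀ s : Fin k → Bool,
    (restrict F (extend s false)).Nonempty → (restrict F (extend s true)).Nonempty →
    HaveCommonInterlacing ![partialSum F f (extend s false), partialSum F f (extend s true)]

/-! ### The polynomials attached to a distribution and a tuple of vectors -/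

/-- `q_S(x) = μ(S) * χ[∑ i ∈ S, 2 v_i v_iᵀ](x²)`, where `χ[M](x) = det (x I - M)`. -/
def q {m d : ℕ} (μ : Finset (Fin m) → ℝ) (v : Fin m → Fin d → ℝ) (S : Finset (Fin m)) : ℝ[X] :=
  C (μ S) * (∑ i ∈ S, (2 : ℝ) • Matrix.vecMulVec (v i) (v i)).charpoly.comp (X ^ 2)

end StronglyRayleigh

end

namespace StronglyRayleigh

/-! Attach to each set `S` a nonnegative product weight `w(S) = ∏ i, θ i [i ∈ S]`. The core claim is
that `∑ S, μ(S) w(S) χ[∑ i ∈ S, v_i v_iᵀ](y)` has no zero in the open upper half-plane when its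
total mass is positive. For positive weights, reweighting keeps `g_μ` stable, and `det (y I + ∑ z_i
v_i v_iᵀ)` is stable as well and affine in each `z_i`. Contracting the two polynomials one variable
at a time preserves nonvanishing (`contraction_ne_zero`, `sum_contraction_ne_zero`) and leaves the
desired sum, up to a shift `c` that tends to `1`. The limit, which also reaches weights that vanish,
is controlled by a bound with explicit constants, `norm_coeff_mul_im_pow_le`. After `y = x²`,
conjugation covers the lower half-plane and positive definiteness covers `y < 0`, so the polynomial
in `x` has only real zeros. Suitable `θ` turn the weighted sum into a single `q_S`, a partial sum,
or `q_{s,0} + t q_{s,1}` with `t > 0`. The absence of nonreal zeros in the whole last family forces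
a common interlacing, by an argument-counting proof (`sum_root_gt_lt`). -/

/-! ### Contraction of multiaffine polynomials. -/

theorem contraction_ne_zero_aux {A C : ℂ}
    (h : ∀ w z : ℂ, 0 ≤ w.im → 0 ≤ z.im → A + C * z + A * (w * z) ≠ 0) : False := by
  have hA : A ≠ 0 := by simpa using h 0 0
  set n : ℝ := 1 + |(C / A).im| with hn
  have hn0 : 0 < n := by positivity
  have hn' : (n : ℂ) ≠ 0 := by exact_mod_cast hn0.ne'
  -- Solving for `w` gives `w = -1/z - C/A`; a small imaginary `z = I/n` makes `-1/z = n I` dominate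
  -- the imaginary part of `C/A`.
  refine h (n * Complex.I - C / A) (Complex.I / n) ?_ ?_ ?_
  · have := le_abs_self (C / A).im
    simp only [Complex.sub_im, Complex.mul_im, Complex.ofReal_re, Complex.I_im, Complex.ofReal_im,
      Complex.I_re]
    linarith
  · rw [Complex.div_ofReal_im, Complex.I_im]
    positivity
  · field_simp
    linear_combination A * n * Complex.I_sq

/-- If a bilinear polynomial has no zeros with both coordinates in the closed upper half-plane,
then neither does its contraction `w z ↦ -1`, `w, z ↦ 0`. -/
theorem contraction_ne_zero {A B C D : ℂ}
    (h : ∀ w z : ℂ, 0 ≤ w.im → 0 ≤ z.im → A + B * w + C * z + D * (w * z) ≠ 0) : A - D ≠ 0 := by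
  intro hAD
  obtain rfl : A = D := sub_eq_zero.1 hAD
  by_cases hB : B = 0
  · exact contraction_ne_zero_aux (A := A) (C := C) fun w z hw hz => by
      simpa [hB] using h w z hw hz
  by_cases hC : C = 0
  · exact contraction_ne_zero_aux (A := A) (C := B) fun w z hw hz => by
      simpa [hC, mul_comm w z] using h z w hz hw
  obtain ⟨w, hw, hwim⟩ : ∃ w : ℂ, w ^ 2 = C / B ∧ 0 ≤ w.im := by
    obtain ⟨w, hw⟩ := IsAlgClosed.exists_pow_nat_eq (C / B) (n := 2) (by norm_num)
    rcases le_total 0 w.im with h0 | h0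
    · exact ⟨w, hw, h0⟩
    · exact ⟨-w, by simpa using hw, by simpa using h0⟩
  have hw0 : w ≠ 0 := by
    rintro rfl
    have : C / B ≠ 0 := div_ne_zero hC hB
    exact this (by simpa using hw.symm)
  -- With `z = -1/w` the terms `A` and `A w z` cancel, and `B w = C/w` by the choice of `w`;
  -- inversion with a sign preserves the half-plane.
  refine h w (-w⁻¹) hwim ?_ ?_
  · rw [Complex.neg_im, Complex.inv_im, neg_div, neg_neg]
    exact div_nonneg hwim (Complex.normSq_nonneg w)
  · rw [eq_div_iff hB] at hw
    field_simp
    linear_combination hw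

section
variable {ι : Type*} [Fintype ι] [DecidableEq ι]

/-- Contracting a multiaffine polynomial `∑ a S u^S` (stable after the shift by `c`) with a
function `h` affine in each variable. -/
theorem sum_contraction_ne_zero {a : Finset ι → ℂ} {h : (ι → ℂ) → ℂ} {c : ℂ} (hc : c ≠ 0)
    (haff : ∀ z i, ∃ α β : ℂ, ∀ t, h (Function.update z i t) = α + β * t)
    (ha : ∀ u : ι → ℂ, (∀ i, c.im ≤ (u i).im) → ∑ S, a S * ∏ i ∈ S, u i ≠ 0)
    (hh : ∀ z : ι → ℂ, (∀ i, 0 ≤ (z i).im) → h z ≠ 0) :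
    ∑ S, a S * c ^ S.card * h (fun i => if i ∈ S then -c⁻¹ else 0) ≠ 0 := by
  suffices H : ∀ U : Finset ι, ∀ u z : ι → ℂ, (∀ i, c.im ≤ (u i).im) → (∀ i, 0 ≤ (z i).im) →
      ∑ S, a S * (∏ i ∈ S, if i ∈ U then c else u i) *
        h (fun i => if i ∈ U then if i ∈ S then -c⁻¹ else 0 else z i) ≠ 0 by
    simpa using H Finset.univ (fun _ => c) 0 (by simp) (by simp)
  intro U
  induction U using Finset.induction_on with
  | empty =>
    intro u z hu hz
    simpa [← Finset.sum_mul] using ⟨ha u hu, hh z hz⟩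
  | insert i U hi ih =>
    intro u z hu hz
    set p : Finset ι → ℂ := fun S => ∏ j ∈ S.erase i, if j ∈ U then c else u j with hp
    set ζ : Finset ι → ι → ℂ := fun S j =>
      if j ∈ U then if j ∈ S then -c⁻¹ else 0 else z j with hζ
    choose α β hαβ using fun S => haff (ζ S) i
    have hprod : ∀ (S : Finset ι) (V : Finset ι) (u' : ι → ℂ) (x : ℂ),
        (∀ j, j ≠ i → (if j ∈ V then c else u' j) = if j ∈ U then c else u j) →
        (if i ∈ V then c else u' i) = x →
        (∏ j ∈ S, if j ∈ V then c else u' j) = if i ∈ S then x * p S else p S := by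
      intro S V u' x h1 h2
      split_ifs with hS
      · rw [← Finset.mul_prod_erase S _ hS, h2]
        congr 1
        exact Finset.prod_congr rfl fun j hj => h1 j (Finset.ne_of_mem_erase hj)
      · rw [hp]
        simp only [Finset.erase_eq_of_notMem hS]
        exact Finset.prod_congr rfl fun j hj => h1 j (by rintro rfl; exact hS hj)
    set A0 := ∑ S, if i ∈ S then 0 else a S * p S * α S with hA0
    set A1 := ∑ S, if i ∈ S then 0 else a S * p S * β S with hA1
    set B0 := ∑ S, if i ∈ S then a S * p S * α S else 0 with hB0
    set B1 := ∑ S, if i ∈ S then a S * p S * β S else 0 with hB1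
    -- Put `u_i = c + w` and `z_i = x` and contract in `w, x`. A set containing `i` contributes `(c
    -- + w)(α + β x)`, which contracts to `c α - β = c (α + β (-c⁻¹))`; this is where the value
    -- `-c⁻¹` comes from.
    have key : (A0 + c * B0) - B1 ≠ 0 := by
      refine contraction_ne_zero (B := B0) (C := A1 + c * B1) fun w x hw hx => ?_
      have := ih (Function.update u i (c + w)) (Function.update z i x)
        (fun j => by
          rcases eq_or_ne j i with rfl | hj
          · simpa using hw
          · simpa [hj] using hu j)
        (fun j => by
          rcases eq_or_ne j i with rfl | hj
          · simpa using hx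
          · simpa [hj] using hz j)
      convert this using 1
      rw [hA0, hA1, hB0, hB1]
      simp only [Finset.sum_mul, Finset.mul_sum, ← Finset.sum_add_distrib]
      refine Finset.sum_congr rfl fun S _ => ?_
      rw [hprod S U _ (c + w) (fun j hj => by simp [hj]) (by simp [hi])]
      have : (fun j => if j ∈ U then if j ∈ S then -c⁻¹ else 0 else Function.update z i x j)
          = Function.update (ζ S) i x := by
        ext j
        rcases eq_or_ne j i with rfl | hj
        · simp [hi]
        · simp [hj, hζ]
      rw [this, hαβ]
      split_ifs <;> ring
    convert key using 1
    rw [hA0, hB0, hB1]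
    simp only [Finset.mul_sum, ← Finset.sum_add_distrib, ← Finset.sum_sub_distrib]
    refine Finset.sum_congr rfl fun S _ => ?_
    rw [hprod S (insert i U) u c (fun j hj => by simp [hj]) (by simp)]
    have : (fun j => if j ∈ insert i U then if j ∈ S then -c⁻¹ else 0 else z j)
        = Function.update (ζ S) i (if i ∈ S then -c⁻¹ else 0) := by
      ext j
      rcases eq_or_ne j i with rfl | hj
      · simp
      · simp [hj, hζ]
    rw [this, hαβ]
    split_ifs
    · field_simp
      ring
    · ring

end

/-! ### Determinants of rank-one pencils. -/

section
variable {ι n : Type*} [Fintype ι] [DecidableEq ι] [Fintype n] [DecidableEq n]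

/-- The determinant is affine along rank-one perturbations. -/
theorem det_add_smul_vecMulVec_affine {K : Type*} [Field K] (M : Matrix n n K) (u v : n → K) :
    ∃ α β : K, ∀ t : K, (M + t • Matrix.vecMulVec u v).det = α + β * t := by
  -- The matrix determinant lemma needs an invertible base point; if none exists on the line, the
  -- determinant vanishes along it.
  by_cases h : ∃ t₀ : K, (M + t₀ • Matrix.vecMulVec u v).det ≠ 0
  · obtain ⟨t₀, h⟩ := h
    set N := M + t₀ • Matrix.vecMulVec u v with hN
    set x := (Matrix.replicateRow Unit v * N⁻¹ * Matrix.replicateCol Unit u) with hx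
    refine ⟨N.det * (1 - t₀ * x () ()), N.det * x () (), fun t => ?_⟩
    have : M + t • Matrix.vecMulVec u v
        = N + Matrix.replicateCol Unit ((t - t₀) • u) * Matrix.replicateRow Unit v := by
      rw [← Matrix.vecMulVec_eq, hN, Matrix.smul_vecMulVec, sub_smul]
      abel
    rw [this, Matrix.det_add_replicateCol_mul_replicateRow (isUnit_iff_ne_zero.2 h),
      Matrix.replicateCol_smul, Matrix.mul_smul, ← hx,
      Matrix.det_unique (n := Unit)]
    simp only [Matrix.add_apply, Matrix.smul_apply, Matrix.one_apply_eq, smul_eq_mul,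
      PUnit.default_eq_unit]
    ring
  · push Not at h
    exact ⟨0, 0, fun t => by simp [h t]⟩

/-- `y I + ∑ z i v_i v_iᵀ` as a complex matrix. -/
noncomputable def pencil (v : ι → n → ℝ) (y : ℂ) (z : ι → ℂ) : Matrix n n ℂ :=
  y • 1 + ∑ i, z i • Matrix.vecMulVec (fun k => (v i k : ℂ)) (fun k => (v i k : ℂ))

theorem det_pencil_affine (v : ι → n → ℝ) (y : ℂ) (z : ι → ℂ) (i : ι) :
    ∃ α β : ℂ, ∀ t, (pencil v y (Function.update z i t)).det = α + β * t := by
  obtain ⟨α, β, h⟩ := det_add_smul_vecMulVec_affine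
    (pencil v y (Function.update z i 0)) (fun k => (v i k : ℂ)) (fun k => (v i k : ℂ))
  refine ⟨α, β, fun t => ?_⟩
  rw [← h t]
  congr 1
  unfold pencil
  rw [add_assoc]
  congr 1
  rw [← Finset.add_sum_erase _ _ (Finset.mem_univ i), ← Finset.add_sum_erase _ _ (Finset.mem_univ i)]
  simp only [Function.update_self, zero_smul, zero_add]
  rw [add_comm]
  congr 1
  refine Finset.sum_congr rfl fun j hj => ?_
  simp [Finset.ne_of_mem_erase hj]

omit [DecidableEq ι] in
-- For a kernel vector `x`, the form `x* M x = y ‖x‖² + ∑ z_i |⟨v_i, x⟩|²` would be zero, yet its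
-- imaginary part is positive.
theorem det_pencil_ne_zero (v : ι → n → ℝ) {y : ℂ} (hy : 0 < y.im) {z : ι → ℂ}
    (hz : ∀ i, 0 ≤ (z i).im) : (pencil v y z).det ≠ 0 := by
  intro h0
  obtain ⟨x, hx0, hx⟩ := Matrix.exists_mulVec_eq_zero_iff.2 h0
  have hform : star x ⬝ᵥ (pencil v y z).mulVec x
      = y * ((∑ k, Complex.normSq (x k) : ℝ) : ℂ)
        + ∑ i, z i * (Complex.normSq (∑ k, (v i k : ℂ) * x k) : ℝ) := by
    unfold pencil
    rw [Matrix.add_mulVec, dotProduct_add]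
    congr 1
    · rw [Matrix.smul_mulVec, Matrix.one_mulVec, dotProduct_smul, smul_eq_mul]
      simp only [dotProduct, Complex.ofReal_sum, Complex.normSq_eq_conj_mul_self, Pi.star_apply,
        RCLike.star_def]
    · rw [Matrix.sum_mulVec, dotProduct_sum]
      refine Finset.sum_congr rfl fun i _ => ?_
      rw [Matrix.smul_mulVec, Matrix.vecMulVec_mulVec, Complex.normSq_eq_conj_mul_self,
        dotProduct_smul, dotProduct_smul, smul_eq_mul, MulOpposite.smul_eq_mul_unop,
        MulOpposite.unop_op]
      simp only [dotProduct, map_sum, map_mul, Complex.conj_ofReal, Pi.star_apply,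
        RCLike.star_def, mul_comm]
  rw [hx, dotProduct_zero] at hform
  have him := congrArg Complex.im hform
  simp only [Complex.zero_im, Complex.add_im, Complex.im_sum, Complex.im_mul_ofReal] at him
  have h1 : 0 < ∑ k, Complex.normSq (x k) := by
    obtain ⟨k, hk⟩ := Function.ne_iff.1 hx0
    exact Finset.sum_pos' (fun k _ => Complex.normSq_nonneg _)
      ⟨k, Finset.mem_univ k, Complex.normSq_pos.2 hk⟩
  have h2 : 0 ≤ ∑ i, (z i).im * Complex.normSq (∑ k, (v i k : ℂ) * x k) :=
    Finset.sum_nonneg fun i _ => mul_nonneg (hz i) (Complex.normSq_nonneg _)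
  have := mul_pos hy h1
  linarith

end

/-! ### Common interlacing from the absence of zeros in the upper half-plane. -/

/-- The straight path from `I` to the real number `x`; its argument. -/
noncomputable def pathArg (x s : ℝ) : ℝ := Complex.arg (s * x + (1 - s) * Complex.I)

theorem pathArg_zero (x : ℝ) : pathArg x 0 = Real.pi / 2 := by
  simp [pathArg]

theorem pathArg_one (x : ℝ) : pathArg x 1 = if x < 0 then Real.pi else 0 := by
  split_ifs with h
  · simpa [pathArg] using Complex.arg_ofReal_of_neg h
  · simpa [pathArg] using Complex.arg_ofReal_of_nonneg (not_lt.1 h)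

theorem continuousOn_pathArg {x : ℝ} (hx : x ≠ 0) : ContinuousOn (pathArg x) (Set.Icc 0 1) := by
  have hc : Continuous fun s : ℝ => (s * x + (1 - s) * Complex.I : ℂ) := by fun_prop
  have him : ∀ s : ℝ, (s * x + (1 - s) * Complex.I : ℂ).im = 1 - s := fun s => by simp
  have hre : ∀ s : ℝ, (s * x + (1 - s) * Complex.I : ℂ).re = s * x := fun s => by simp
  have hmaps : Set.MapsTo (fun s : ℝ => (s * x + (1 - s) * Complex.I : ℂ)) (Set.Icc 0 1)
      {z : ℂ | 0 ≤ z.im} := fun s hs => by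
    rw [Set.mem_ofPred_eq, him]
    linarith [hs.2]
  intro s hs
  by_cases h : (s * x + (1 - s) * Complex.I : ℂ) ∈ Complex.slitPlane
  · exact ((Complex.continuousAt_arg h).comp
      (f := fun s : ℝ => (s * x + (1 - s) * Complex.I : ℂ)) hc.continuousAt).continuousWithinAt
  · rw [Complex.mem_slitPlane_iff, him, hre] at h
    push Not at h
    -- The path meets the branch cut only at its endpoint, and from above, where `arg` is
    -- one-sidedly continuous.
    have hs1 : s = 1 := by linarith [h.2]
    subst hs1
    have hx' : x < 0 := lt_of_le_of_ne (by simpa using h.1) hx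
    exact (Complex.continuousWithinAt_arg_of_re_neg_of_im_zero
      (z := ((1 : ℝ) * x + (1 - (1 : ℝ)) * Complex.I : ℂ)) (by rw [hre]; linarith)
      (by rw [him]; norm_num)).comp (f := fun s : ℝ => (s * x + (1 - s) * Complex.I : ℂ)) hc.continuousWithinAt hmaps

/-- If `f₀ + s f₁` has no roots in the upper half-plane for all `s > 0`, then the numbers of roots
of `f₀` and of `f₁` beyond `t` differ by at most one. -/
theorem sum_root_gt_lt {N : ℕ} {β γ : Fin N → ℝ} {b c : ℝ} (hb : 0 < b) (hc : 0 < c)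
    (h : ∀ s : ℝ, 0 < s → ∀ z : ℂ, 0 < z.im →
      b * ∏ i, (z - β i) + s * (c * ∏ i, (z - γ i)) ≠ 0)
    {t : ℝ} (hβ : ∀ i, t ≠ β i) (hγ : ∀ i, t ≠ γ i) :
    (∑ i, if t < β i then (1 : ℝ) else 0) < (∑ i, if t < γ i then (1 : ℝ) else 0) + 2 := by
  by_contra! hcon
  set A : ℝ → ℝ := fun s => ∑ i, pathArg (t - β i) s - ∑ i, pathArg (t - γ i) s with hA
  have hcont : ContinuousOn A (Set.Icc 0 1) :=
    (continuousOn_finsetSum _ fun i _ => continuousOn_pathArg (sub_ne_zero.2 (hβ i))).sub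
      (continuousOn_finsetSum _ fun i _ => continuousOn_pathArg (sub_ne_zero.2 (hγ i)))
  have hA0 : A 0 = 0 := by simp [hA, pathArg_zero]
  have hA1 : A 1 = Real.pi * ((∑ i, if t < β i then (1 : ℝ) else 0)
      - ∑ i, if t < γ i then (1 : ℝ) else 0) := by
    simp only [hA, pathArg_one,
      sub_neg, mul_sub, Finset.mul_sum, mul_ite, mul_one, mul_zero]
  have hpi := Real.pi_pos
  have hA1' : 2 * Real.pi ≤ A 1 := by
    rw [hA1]
    nlinarith
  -- A discrepancy of two roots makes `A 1` at least `2π`, so the value `π` is reached at an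
  -- interior `s`, hence at a nonreal `z`.
  obtain ⟨s, hs, hsA⟩ := intermediate_value_Icc zero_le_one hcont
    (show Real.pi ∈ Set.Icc (A 0) (A 1) from ⟨by linarith, by linarith⟩)
  have hs0 : 0 < s := lt_of_le_of_ne hs.1 (by rintro rfl; linarith)
  have hs1 : s < 1 := lt_of_le_of_ne hs.2 (by rintro rfl; linarith)
  -- Chosen so that `s (z - x) = s (t - x) + (1 - s) I`, the point on the path. The two products at
  -- `z` then have opposite directions, and a positive multiplier cancels them.
  set z : ℂ := ⟨t, (1 - s) / s⟩ with hz
  have hzim : 0 < z.im := div_pos (by linarith) hs0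
  have hfac : ∀ x : ℝ, z - x = (‖z - x‖ : ℂ) * Complex.exp (pathArg (t - x) s * Complex.I) := by
    intro x
    have : pathArg (t - x) s = (z - x).arg := by
      rw [pathArg, ← Complex.arg_real_mul (z - x) hs0]
      congr 1
      apply Complex.ext
      · simp [hz]
      · simp [hz]
        field_simp
    rw [this, Complex.norm_mul_exp_arg_mul_I]
  have hne : ∀ x : ℝ, 0 < ‖z - x‖ := fun x => by
    rw [norm_pos_iff]
    intro h0
    have := congrArg Complex.im h0
    simp at this
    linarith
  have hprod : ∀ δ : Fin N → ℝ, ∏ i, (z - δ i) = ((∏ i, ‖z - δ i‖ : ℝ) : ℂ)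
      * Complex.exp ((∑ i, pathArg (t - δ i) s : ℝ) * Complex.I) := by
    intro δ
    rw [Finset.prod_congr rfl fun i _ => hfac (δ i), Finset.prod_mul_distrib, ← Complex.exp_sum]
    push_cast
    rw [Finset.sum_mul]
  set P := ∏ i, ‖z - β i‖ with hP
  set Q := ∏ i, ‖z - γ i‖ with hQ
  have hP0 : 0 < P := Finset.prod_pos fun i _ => hne _
  have hQ0 : 0 < Q := Finset.prod_pos fun i _ => hne _
  refine h (b * P / (c * Q)) (by positivity) z hzim ?_
  have hsum : (∑ i, pathArg (t - β i) s) = Real.pi + ∑ i, pathArg (t - γ i) s := by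
    have := hsA
    simp only [hA] at this
    linarith
  rw [hprod β, hprod γ, hsum]
  rw [← hP, ← hQ, Complex.ofReal_add, add_mul, Complex.exp_add, Complex.exp_pi_mul_I]
  push_cast
  have hc' : (c : ℂ) ≠ 0 := by exact_mod_cast hc.ne'
  have hQ' : (Q : ℂ) ≠ 0 := by exact_mod_cast hQ0.ne'
  field_simp
  ring

/-- If it failed, a `t` strictly between the two roots would have at least `n + 1 - i` of the `β`
and at most `n - 1 - i` of the `γ` above it, a discrepancy of two. -/
theorem sorted_roots_le {n : ℕ} {β γ : Fin (n + 1) → ℝ} (mβ : Monotone β) (mγ : Monotone γ)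
    {b c : ℝ} (hb : 0 < b) (hc : 0 < c)
    (h : ∀ s : ℝ, 0 < s → ∀ z : ℂ, 0 < z.im →
      b * ∏ i, (z - β i) + s * (c * ∏ i, (z - γ i)) ≠ 0) (i : Fin n) :
    β i.castSucc ≤ γ i.succ := by
  by_contra! hlt
  obtain ⟨t, ⟨ht1, ht2⟩, ht⟩ := (Set.Ioo_infinite hlt).exists_notMem_finset
    (Finset.univ.image β ∪ Finset.univ.image γ)
  simp only [Finset.mem_union, Finset.mem_image, Finset.mem_univ, true_and, not_or,
    not_exists] at ht
  have key := sum_root_gt_lt hb hc h (fun i hi => ht.1 i hi.symm) (fun i hi => ht.2 i hi.symm)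
  have h1 : (Finset.Ici i.castSucc).card ≤ (Finset.univ.filter fun j => t < β j).card :=
    Finset.card_le_card fun j hj => by
      simpa using ht2.trans_le (mβ (Finset.mem_Ici.1 hj))
  have h2 : (Finset.univ.filter fun j => t < γ j).card ≤ (Finset.Ioi i.succ).card :=
    Finset.card_le_card fun j hj => by
      rw [Finset.mem_Ioi]
      by_contra! hle
      have := mγ hle
      have h3 : t < γ j := by simpa using hj
      linarith
  rw [Fin.card_Ici] at h1
  rw [Fin.card_Ioi] at h2
  simp only [Finset.sum_boole] at key
  have key' : (Finset.univ.filter fun j => t < β j).card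
      < (Finset.univ.filter fun j => t < γ j).card + 2 := by exact_mod_cast key
  have := i.isLt
  simp only [Fin.val_castSucc, Fin.val_succ] at h1 h2
  omega

theorem exists_sorted_roots {f : ℝ[X]} (hf : f.Splits) {N : ℕ} (hN : f.natDegree = N) :
    ∃ β : Fin N → ℝ, Monotone β ∧ f = C f.leadingCoeff * ∏ i, (X - C (β i)) := by
  have hlen : (f.roots.sort (· ≤ ·)).length = N := by
    rw [Multiset.length_sort, ← hf.natDegree_eq_card_roots, hN]
  subst hlen
  refine ⟨(f.roots.sort (· ≤ ·)).get, ?_, ?_⟩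
  · exact (Multiset.pairwise_sort f.roots (· ≤ ·)).sortedLE.monotone_get
  · conv_lhs => rw [hf.eq_prod_roots]
    congr 1
    conv_lhs => rw [← Multiset.sort_eq f.roots (· ≤ ·), Multiset.map_coe, Multiset.prod_coe,
      ← List.ofFn_get (f.roots.sort (· ≤ ·)), List.map_ofFn, List.prod_ofFn]
    rfl

theorem haveCommonInterlacing_of_ne_zero {n : ℕ} {f₀ f₁ : ℝ[X]}
    (h₀ : f₀.Splits) (h₁ : f₁.Splits) (d₀ : f₀.natDegree = n + 1) (d₁ : f₁.natDegree = n + 1)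
    (l₀ : 0 < f₀.leadingCoeff) (l₁ : 0 < f₁.leadingCoeff)
    (h : ∀ s : ℝ, 0 < s → ∀ z : ℂ, 0 < z.im → aeval z f₀ + s * aeval z f₁ ≠ 0) :
    HaveCommonInterlacing ![f₀, f₁] := by
  obtain ⟨β, mβ, hβ⟩ := exists_sorted_roots h₀ d₀
  obtain ⟨γ, mγ, hγ⟩ := exists_sorted_roots h₁ d₁
  have e₀ : ∀ z : ℂ, aeval z f₀ = f₀.leadingCoeff * ∏ i, (z - β i) := fun z => by
    conv_lhs => rw [hβ]
    simp [map_prod]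
  have e₁ : ∀ z : ℂ, aeval z f₁ = f₁.leadingCoeff * ∏ i, (z - γ i) := fun z => by
    conv_lhs => rw [hγ]
    simp [map_prod]
  have hβγ := sorted_roots_le mβ mγ l₀ l₁ fun s hs z hz => by
    rw [← e₀, ← e₁]
    exact h s hs z hz
  have hγβ := sorted_roots_le mγ mβ l₁ l₀ fun s hs z hz => by
    rw [← e₀, ← e₁]
    intro h0
    refine h s⁻¹ (inv_pos.2 hs) z hz ?_
    have : (s : ℂ) ≠ 0 := by exact_mod_cast hs.ne'
    push_cast
    field_simp
    linear_combination h0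
  -- The larger of the two `i`-th roots lies below both `(i+1)`-st roots, by monotonicity and the
  -- two cross inequalities.
  refine ⟨C 1 * ∏ i : Fin n, (X - C (max (β i.castSucc) (γ i.castSucc))), fun j => ?_⟩
  fin_cases j
  · exact ⟨n, 1, f₀.leadingCoeff, _, β, one_ne_zero, l₀.ne', rfl, hβ, fun i =>
      ⟨le_max_left _ _, max_le (mβ (Fin.castSucc_lt_succ).le) (hγβ i)⟩⟩
  · exact ⟨n, 1, f₁.leadingCoeff, _, γ, one_ne_zero, l₁.ne', rfl, hγ, fun i =>
      ⟨le_max_right _ _, max_le (hβγ i) (mγ (Fin.castSucc_lt_succ).le)⟩⟩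

/-! ### A lower bound in the upper half-plane that survives limits. -/

theorem im_pow_card_le_norm_prod {y : ℂ} (hy : 0 < y.im) (s : Multiset ℂ)
    (hs : ∀ a ∈ s, a.im ≤ 0) : y.im ^ s.card ≤ ‖(s.map (y - ·)).prod‖ := by
  induction s using Multiset.induction_on with
  | empty => simp
  | cons a s ih =>
    rw [Multiset.card_cons, Multiset.map_cons, Multiset.prod_cons, norm_mul, pow_succ']
    refine mul_le_mul ?_ (ih fun b hb => hs b (Multiset.mem_cons_of_mem hb)) (by positivity)
      (norm_nonneg _)
    have h1 := hs a (Multiset.mem_cons_self a s)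
    have h2 := (le_abs_self _).trans (Complex.abs_im_le_norm (y - a))
    rw [Complex.sub_im] at h2
    linarith

/-- A quantitative form of Hurwitz' theorem: a polynomial without roots in the upper half-plane is
bounded below there in terms of its top coefficient. -/
theorem norm_coeff_mul_im_pow_le {p : ℂ[X]} {d : ℕ} (hd : p.natDegree ≤ d)
    (hp : ∀ y : ℂ, 0 < y.im → p.eval y ≠ 0) {y : ℂ} (hy : 0 < y.im) :
    ‖p.coeff d‖ * y.im ^ d ≤ ‖p.eval y‖ := by
  rcases hd.lt_or_eq with h | rfl
  · rw [coeff_eq_zero_of_natDegree_lt h]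
    simp
  · have hsp : p.Splits := IsAlgClosed.splits p
    rw [hsp.eval_eq_prod_roots, norm_mul, coeff_natDegree, hsp.natDegree_eq_card_roots]
    refine mul_le_mul_of_nonneg_left (im_pow_card_le_norm_prod hy _ fun a ha => ?_) (norm_nonneg _)
    by_contra! h
    exact hp a h (isRoot_of_mem_roots ha)

/-- A product weight on the subsets of `[m]`. -/
noncomputable def weight {m : ℕ} (θ : Fin m → Bool → ℝ) (S : Finset (Fin m)) : ℝ :=
  ∏ i, θ i (decide (i ∈ S))

/-! ### Weighted sums of characteristic polynomials. -/

section
variable {m : ℕ} {μ : Finset (Fin m) → ℝ} {n : Type*} [Fintype n] [DecidableEq n]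

theorem IsStronglyRayleigh.sum_ne_zero (h : IsStronglyRayleigh μ) {u : Fin m → ℂ}
    (hu : ∀ i, 0 < (u i).im) : ∑ S, (μ S : ℂ) * ∏ i ∈ S, u i ≠ 0 := by
  have := h u hu
  simpa [genPoly, map_sum, map_prod, MvPolynomial.eval_map] using this

/-- Up to the constant `∏ θ i false`, the weight rescales each variable by the positive ratio `θ i
true / θ i false`, which preserves the upper half-plane. -/
theorem IsStronglyRayleigh.sum_weight_ne_zero (h : IsStronglyRayleigh μ)
    {θ : Fin m → Bool → ℝ} (hθ : ∀ i b, 0 < θ i b) {u : Fin m → ℂ}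
    (hu : ∀ i, 0 < (u i).im) : ∑ S, ((μ S * weight θ S : ℝ) : ℂ) * ∏ i ∈ S, u i ≠ 0 := by
  have key := h.sum_ne_zero (u := fun i => ((θ i true / θ i false : ℝ) : ℂ) * u i) fun i => by
    rw [Complex.im_ofReal_mul]
    exact mul_pos (div_pos (hθ i true) (hθ i false)) (hu i)
  have hc : ((∏ i, θ i false : ℝ) : ℂ) ≠ 0 := by
    exact_mod_cast (Finset.prod_pos fun i _ => hθ i false).ne'
  have hw : ∀ S, weight θ S = (∏ i, θ i false) * ∏ i ∈ S, θ i true / θ i false := fun S => by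
    rw [← Fintype.prod_ite_mem S, ← Finset.prod_mul_distrib, weight]
    refine Finset.prod_congr rfl fun i _ => ?_
    by_cases hi : i ∈ S
    · simp only [hi, decide_true, if_true]
      rw [mul_div_cancel₀ _ (hθ i false).ne']
    · simp [hi]
  convert mul_ne_zero hc key using 1
  rw [Finset.mul_sum]
  refine Finset.sum_congr rfl fun S _ => ?_
  rw [hw, Finset.prod_mul_distrib]
  push_cast
  ring

/-- `χ[∑ i ∈ S, v_i v_iᵀ]`. -/
noncomputable def gramCharpoly (v : Fin m → n → ℝ) (S : Finset (Fin m)) : ℝ[X] :=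
  (∑ i ∈ S, Matrix.vecMulVec (v i) (v i)).charpoly

/-- `∑ S, μ(S) w(S) χ[∑ i ∈ S, v_i v_iᵀ]` for the product weight `w` given by `θ`. -/
noncomputable def mixedCharpoly (μ : Finset (Fin m) → ℝ) (v : Fin m → n → ℝ) (θ : Fin m → Bool → ℝ) : ℝ[X] :=
  ∑ S, C (μ S * weight θ S) * gramCharpoly v S

theorem eval_charpoly_pencil (v : Fin m → n → ℝ) (y : ℂ) (z : Fin m → ℂ) :
    (∑ i, -z i • Matrix.vecMulVec (fun k => (v i k : ℂ)) (fun k => (v i k : ℂ))).charpoly.eval y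
      = (pencil v y z).det := by
  rw [Matrix.eval_charpoly, pencil]
  congr 1
  simp only [neg_smul, Finset.sum_neg_distrib, sub_neg_eq_add]
  rw [Matrix.smul_one_eq_diagonal]
  rfl

theorem aeval_gramCharpoly (v : Fin m → n → ℝ) (S : Finset (Fin m)) (y : ℂ) :
    aeval y (gramCharpoly v S) = (pencil v y fun i => if i ∈ S then -1 else 0).det := by
  rw [← eval_charpoly_pencil, aeval_def, ← eval_map, gramCharpoly, ← Matrix.charpoly_map]
  congr 2
  ext a b
  simp only [Matrix.map_apply, Matrix.sum_apply, Matrix.smul_apply, smul_eq_mul,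
    Matrix.vecMulVec_apply, Complex.coe_algebraMap, Complex.ofReal_sum, Complex.ofReal_mul, neg_ite, neg_neg, neg_zero,
    ite_mul, one_mul, zero_mul, Finset.sum_ite_mem, Finset.univ_inter]

theorem aeval_mixedCharpoly (v : Fin m → n → ℝ) (θ : Fin m → Bool → ℝ) (y : ℂ) :
    aeval y (mixedCharpoly μ v θ) = ∑ S, ((μ S * weight θ S : ℝ) : ℂ) *
      (pencil v y fun i => if i ∈ S then -1 else 0).det := by
  simp only [mixedCharpoly, map_sum, map_mul, aeval_C, aeval_gramCharpoly, Complex.coe_algebraMap,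
    Complex.ofReal_mul]

/-- Contraction shows that the sum, as a polynomial in `y`, has no zero in the upper half-plane. The
bound, unlike mere nonvanishing, passes to limits in `c` and `θ`. -/
theorem IsStronglyRayleigh.norm_sum_pencil_ge (h : IsStronglyRayleigh μ) (v : Fin m → n → ℝ)
    {θ : Fin m → Bool → ℝ} (hθ : ∀ i b, 0 < θ i b) {c : ℂ} (hc : 0 < c.im) {y : ℂ}
    (hy : 0 < y.im) :
    ‖∑ S, ((μ S * weight θ S : ℝ) : ℂ) * c ^ S.card‖ * y.im ^ Fintype.card n ≤
      ‖∑ S, ((μ S * weight θ S : ℝ) : ℂ) * c ^ S.card *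
        (pencil v y fun i => if i ∈ S then -c⁻¹ else 0).det‖ := by
  have hc0 : c ≠ 0 := by
    rintro rfl
    simp at hc
  set p : ℂ[X] := ∑ S, C (((μ S * weight θ S : ℝ) : ℂ) * c ^ S.card) *
    (∑ i, -(if i ∈ S then -c⁻¹ else 0) •
      Matrix.vecMulVec (fun k => (v i k : ℂ)) (fun k => (v i k : ℂ))).charpoly with hp
  have heval : ∀ y, p.eval y = ∑ S, ((μ S * weight θ S : ℝ) : ℂ) * c ^ S.card *
      (pencil v y fun i => if i ∈ S then -c⁻¹ else 0).det := fun y => by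
    rw [hp, eval_finsetSum]
    refine Finset.sum_congr rfl fun S _ => ?_
    rw [eval_mul, eval_C, eval_charpoly_pencil v y fun i => if i ∈ S then -c⁻¹ else 0]
  have hcoeff : p.coeff (Fintype.card n) = ∑ S, ((μ S * weight θ S : ℝ) : ℂ) * c ^ S.card := by
    rw [hp, finsetSum_coeff]
    refine Finset.sum_congr rfl fun S _ => ?_
    rw [coeff_C_mul]
    conv_lhs => rw [← Matrix.charpoly_natDegree_eq_dim (∑ i, -(if i ∈ S then -c⁻¹ else 0) •
      Matrix.vecMulVec (fun k => (v i k : ℂ)) (fun k => (v i k : ℂ)))]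
    rw [coeff_natDegree, (Matrix.charpoly_monic _).leadingCoeff, mul_one]
  have hdeg : p.natDegree ≤ Fintype.card n := natDegree_sum_le_of_forall_le _ _ fun S _ =>
    (natDegree_C_mul_le _ _).trans (Matrix.charpoly_natDegree_eq_dim _).le
  rw [← heval, ← hcoeff]
  refine norm_coeff_mul_im_pow_le hdeg (fun y hy => ?_) hy
  rw [heval]
  exact sum_contraction_ne_zero hc0 (fun z i => det_pencil_affine v y z i)
    (fun u hu => h.sum_weight_ne_zero hθ fun i => hc.trans_le (hu i))
    fun z hz => det_pencil_ne_zero v hy hz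

theorem IsStronglyRayleigh.norm_mass_mul_le (h : IsStronglyRayleigh μ) (v : Fin m → n → ℝ)
    {θ : Fin m → Bool → ℝ} (hθ : ∀ i b, 0 ≤ θ i b) {y : ℂ} (hy : 0 < y.im) :
    ‖∑ S, ((μ S * weight θ S : ℝ) : ℂ)‖ * y.im ^ Fintype.card n ≤
      ‖aeval y (mixedCharpoly μ v θ)‖ := by
  rw [aeval_mixedCharpoly]
  set W : ℝ → Finset (Fin m) → ℂ := fun t S => ((μ S * weight (fun i b => θ i b + t) S : ℝ) : ℂ)
  -- For `t > 0` the shift lies in the upper half-plane and the weights `θ + t` are positive; as `t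
  -- → 0⁺`, `c → 1` gives the evaluation at `-1` on `S`.
  set c : ℝ → ℂ := fun t => 1 + t * Complex.I with hc
  have hc0 : ∀ t, c t ≠ 0 := fun t h0 => by
    have := congrArg Complex.re h0
    simp [hc] at this
  have hW : ∀ S, Continuous fun t => W t S := fun S => by
    unfold W weight
    fun_prop
  have hcc : Continuous c := by fun_prop
  have hcinv : Continuous fun t => (c t)⁻¹ := hcc.inv₀ hc0
  have hL : Continuous fun t => ‖∑ S, W t S * c t ^ S.card‖ * y.im ^ Fintype.card n := by
    fun_prop
  have hR : Continuous fun t => ‖∑ S, W t S * c t ^ S.card *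
      (pencil v y fun i => if i ∈ S then -(c t)⁻¹ else 0).det‖ := by
    refine (continuous_finsetSum _ fun S _ => ((hW S).mul (hcc.pow _)).mul ?_).norm
    refine Continuous.matrix_det ?_
    unfold pencil
    refine continuous_const.add (continuous_finsetSum _ fun i _ => ?_)
    by_cases hi : i ∈ S
    · simp only [hi, if_true]
      exact hcinv.neg.smul continuous_const
    · simp only [hi, if_false]
      exact continuous_const
  have key := le_of_tendsto_of_tendsto
    ((hL.tendsto 0).mono_left (nhdsWithin_le_nhds (s := Set.Ioi 0)))
    ((hR.tendsto 0).mono_left (nhdsWithin_le_nhds (s := Set.Ioi 0)))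
    (Filter.eventually_of_mem self_mem_nhdsWithin fun t ht =>
      h.norm_sum_pencil_ge v (θ := fun i b => θ i b + t) (c := c t)
        (fun i b => add_pos_of_nonneg_of_pos (hθ i b) ht) (by simpa [hc] using ht) hy)
  simpa [W, hc] using key

variable (μ) in
/-- The total mass of `μ` reweighted by `θ`. -/
noncomputable def mass (θ : Fin m → Bool → ℝ) : ℝ := ∑ S, μ S * weight θ S

theorem natDegree_gramCharpoly (v : Fin m → n → ℝ) (S : Finset (Fin m)) :
    (gramCharpoly v S).natDegree = Fintype.card n := Matrix.charpoly_natDegree_eq_dim _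

theorem coeff_mixedCharpoly (v : Fin m → n → ℝ) (θ : Fin m → Bool → ℝ) :
    (mixedCharpoly μ v θ).coeff (Fintype.card n) = mass μ θ := by
  rw [mixedCharpoly, finsetSum_coeff, mass]
  refine Finset.sum_congr rfl fun S _ => ?_
  rw [coeff_C_mul, ← natDegree_gramCharpoly v S, coeff_natDegree, gramCharpoly,
    (Matrix.charpoly_monic _).leadingCoeff, mul_one]

theorem natDegree_mixedCharpoly (v : Fin m → n → ℝ) {θ : Fin m → Bool → ℝ} (hm : 0 < mass μ θ) :
    (mixedCharpoly μ v θ).natDegree = Fintype.card n := by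
  refine natDegree_eq_of_le_of_coeff_ne_zero (natDegree_sum_le_of_forall_le _ _ fun S _ => ?_) ?_
  · exact (natDegree_C_mul_le _ _).trans (natDegree_gramCharpoly v S).le
  · rw [coeff_mixedCharpoly]
    exact hm.ne'

/-- For `y < 0` the matrix `-y I + ∑ v_i v_iᵀ` is positive definite. The sign does not depend on
`S`, so weighted sums cannot cancel. -/
theorem neg_one_pow_mul_eval_gramCharpoly_pos (v : Fin m → n → ℝ) (S : Finset (Fin m)) {y : ℝ}
    (hy : y < 0) : 0 < (-1) ^ Fintype.card n * (gramCharpoly v S).eval y := by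
  rw [gramCharpoly, Matrix.eval_charpoly, ← Matrix.det_neg, neg_sub, sub_eq_add_neg, add_comm]
  refine Matrix.PosDef.det_pos (Matrix.PosDef.add_posSemidef ?_ ?_)
  · have : -(Matrix.scalar n) y = Matrix.diagonal fun _ => -y := by
      ext a b
      simp [Matrix.diagonal_apply]
      split_ifs <;> simp
    rw [this]
    exact Matrix.PosDef.diagonal fun _ => by linarith
  · refine Matrix.posSemidef_sum _ fun i _ => ?_
    simpa using Matrix.posSemidef_vecMulVec_self_star (v i)

theorem eval_mixedCharpoly_ne_zero (hμ : ∀ S, 0 ≤ μ S) (v : Fin m → n → ℝ)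
    {θ : Fin m → Bool → ℝ} (hθ : ∀ i b, 0 ≤ θ i b) (hm : 0 < mass μ θ) {y : ℝ} (hy : y < 0) :
    (mixedCharpoly μ v θ).eval y ≠ 0 := by
  have hw : ∀ S, 0 ≤ μ S * weight θ S := fun S =>
    mul_nonneg (hμ S) (Finset.prod_nonneg fun i _ => hθ i _)
  obtain ⟨S₀, -, hS₀⟩ := Finset.exists_lt_of_sum_lt (s := Finset.univ)
    (f := fun _ : Finset (Fin m) => (0 : ℝ)) (by simpa [mass] using hm)
  have : 0 < (-1) ^ Fintype.card n * (mixedCharpoly μ v θ).eval y := by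
    rw [mixedCharpoly, eval_finsetSum, Finset.mul_sum]
    simp only [eval_mul, eval_C, mul_left_comm _ (μ _ * weight θ _)]
    exact Finset.sum_pos'
      (fun S _ => mul_nonneg (hw S) (neg_one_pow_mul_eval_gramCharpoly_pos v S hy).le)
      ⟨S₀, Finset.mem_univ _, mul_pos hS₀ (neg_one_pow_mul_eval_gramCharpoly_pos v S₀ hy)⟩
  intro h0
  simp [h0] at this

/-- The square of a nonreal number is nonreal or negative; stability, conjugation and the constant
sign on the negative axis cover these cases. -/
theorem IsStronglyRayleigh.aeval_mixedCharpoly_sq_ne_zero (h : IsStronglyRayleigh μ)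
    (hμ : ∀ S, 0 ≤ μ S) (v : Fin m → n → ℝ) {θ : Fin m → Bool → ℝ} (hθ : ∀ i b, 0 ≤ θ i b)
    (hm : 0 < mass μ θ) {x : ℂ} (hx : x.im ≠ 0) :
    aeval x ((mixedCharpoly μ v θ).comp (X ^ 2)) ≠ 0 := by
  have hupper : ∀ y : ℂ, 0 < y.im → aeval y (mixedCharpoly μ v θ) ≠ 0 := fun y hy h0 => by
    have := h.norm_mass_mul_le v hθ hy
    rw [h0, norm_zero, ← Complex.ofReal_sum, Complex.norm_real] at this
    have h1 : 0 < ‖mass μ θ‖ * y.im ^ Fintype.card n :=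
      mul_pos (norm_pos_iff.2 hm.ne') (pow_pos hy _)
    exact absurd this (not_le.2 h1)
  rw [aeval_comp, aeval_X_pow]
  rcases lt_trichotomy (x ^ 2).im 0 with hlt | heq | hgt
  · intro h0
    refine hupper (starRingEnd ℂ (x ^ 2)) (by simpa only [Complex.conj_im, neg_pos] using hlt) ?_
    rw [aeval_conj, h0, map_zero]
  · have hre : x.re = 0 := by
      have : 2 * (x.re * x.im) = 0 := by
        rw [← heq, sq, Complex.mul_im]
        ring
      simpa [hx] using this
    have hy : x ^ 2 = ((-(x.im ^ 2) : ℝ) : ℂ) := by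
      apply Complex.ext
      · simp [sq, hre]
      · rw [heq, Complex.ofReal_im]
    rw [hy, ← Complex.coe_algebraMap, aeval_algebraMap_apply_eq_algebraMap_eval]
    simpa using eval_mixedCharpoly_ne_zero hμ v hθ hm (neg_lt_zero.2 (by positivity))
  · exact hupper _ hgt

end

theorem splits_of_aeval_ne_zero {f : ℝ[X]} (h : ∀ x : ℂ, x.im ≠ 0 → aeval x f ≠ 0) :
    f.Splits := by
  refine Splits.of_splits_map (algebraMap ℝ ℂ) (IsAlgClosed.splits _) fun a ha => ?_
  have h0 : aeval a f = 0 := by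
    rw [aeval_def, ← eval_map]
    exact isRoot_of_mem_roots ha
  refine ⟨a.re, Complex.ext (by simp) ?_⟩
  by_contra him
  exact h a (fun h1 => him (by simp [h1])) h0

/-! ### The polynomials `q_S` and their partial sums. -/

section
variable {m d : ℕ} {μ : Finset (Fin m) → ℝ}

theorem q_eq (v : Fin m → Fin d → ℝ) (S : Finset (Fin m)) :
    q μ v S = C (μ S) * (gramCharpoly (fun i => √2 • v i) S).comp (X ^ 2) := by
  have : ∀ i, Matrix.vecMulVec (√2 • v i) (√2 • v i) = (2 : ℝ) • Matrix.vecMulVec (v i) (v i) := by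
    intro i
    ext a b
    simp only [Matrix.vecMulVec_apply, Pi.smul_apply, smul_eq_mul, Matrix.smul_apply]
    linear_combination (v i a * v i b) * Real.mul_self_sqrt (zero_le_two (α := ℝ))
  simp only [q, gramCharpoly, this]

theorem sum_weight_mul_q (v : Fin m → Fin d → ℝ) (θ : Fin m → Bool → ℝ) :
    ∑ S, C (weight θ S) * q μ v S = (mixedCharpoly μ (fun i => √2 • v i) θ).comp (X ^ 2) := by
  rw [mixedCharpoly, Polynomial.sum_comp]
  refine Finset.sum_congr rfl fun S _ => ?_
  rw [q_eq, mul_comp, C_comp, C_mul]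
  ring

theorem natDegree_sum_weight_mul_q (v : Fin m → Fin d → ℝ) {θ : Fin m → Bool → ℝ}
    (hm : 0 < mass μ θ) : (∑ S, C (weight θ S) * q μ v S).natDegree = d * 2 := by
  rw [sum_weight_mul_q, natDegree_comp, natDegree_mixedCharpoly _ hm, natDegree_X_pow,
    Fintype.card_fin]

theorem leadingCoeff_sum_weight_mul_q (v : Fin m → Fin d → ℝ) {θ : Fin m → Bool → ℝ}
    (hm : 0 < mass μ θ) : (∑ S, C (weight θ S) * q μ v S).leadingCoeff = mass μ θ := by
  rw [sum_weight_mul_q, leadingCoeff_comp (by simp), leadingCoeff_X_pow, one_pow, mul_one,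
    leadingCoeff, natDegree_mixedCharpoly _ hm, coeff_mixedCharpoly]

theorem IsStronglyRayleigh.aeval_sum_weight_mul_q_ne_zero (h : IsStronglyRayleigh μ)
    (hμ : ∀ S, 0 ≤ μ S) (v : Fin m → Fin d → ℝ) {θ : Fin m → Bool → ℝ} (hθ : ∀ i b, 0 ≤ θ i b)
    (hm : 0 < mass μ θ) {x : ℂ} (hx : x.im ≠ 0) :
    aeval x (∑ S, C (weight θ S) * q μ v S) ≠ 0 := by
  rw [sum_weight_mul_q]
  exact h.aeval_mixedCharpoly_sq_ne_zero hμ _ hθ hm hx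

/-- The weight selecting the sets with pattern `s` on the first `k` elements, with the element `k`
weighted by `r`. -/
noncomputable def prefixWeight {k : ℕ} (s : Fin k → Bool) (r : Bool → ℝ) (i : Fin m) (b : Bool) : ℝ :=
  if h : i.val < k then if b = s ⟨i.val, h⟩ then 1 else 0 else if i.val = k then r b else 1

theorem prefixWeight_nonneg {k : ℕ} (s : Fin k → Bool) {r : Bool → ℝ} (hr : ∀ b, 0 ≤ r b)
    (i : Fin m) (b : Bool) : 0 ≤ prefixWeight s r i b := by
  unfold prefixWeight
  split_ifs <;> first | exact hr b | norm_num

theorem mem_restrict_extend {F : Finset (Finset (Fin m))} {k : ℕ} (hk : k < m)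
    (s : Fin k → Bool) (b : Bool) (S : Finset (Fin m)) :
    S ∈ restrict F (extend s b) ↔
      S ∈ F ∧ (∀ (i : Fin m) (h : i.val < k), i ∈ S ↔ s ⟨i.val, h⟩ = true) ∧
        decide ((⟨k, hk⟩ : Fin m) ∈ S) = b := by
  have hlt : ∀ (i : Fin m) (h : i.val < k) (h' : i.val < k + 1),
      extend s b ⟨i.val, h'⟩ = s ⟨i.val, h⟩ := fun i h h' => by
    simpa [extend] using Fin.snoc_castSucc (α := fun _ => Bool) b s ⟨i.val, h⟩
  have hlast : ∀ h' : k < k + 1, extend s b ⟨k, h'⟩ = b := fun h' => by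
    exact Fin.snoc_last (α := fun _ => Bool) b s
  rw [restrict, Finset.mem_filter]
  refine and_congr_right fun _ => ⟨fun H => ⟨fun i h => ?_, ?_⟩, fun H i h => ?_⟩
  · rw [H i (h.trans k.lt_succ_self), hlt i h]
  · have := H ⟨k, hk⟩ k.lt_succ_self
    rw [hlast] at this
    rw [Bool.eq_iff_iff, decide_eq_true_iff, this]
  · rcases (Nat.lt_succ_iff_lt_or_eq.1 h) with h1 | h1
    · rw [hlt i h1, H.1 i h1]
    · obtain rfl : i = ⟨k, hk⟩ := Fin.ext h1
      rw [hlast, ← H.2, decide_eq_true_iff]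

theorem weight_prefixWeight {F : Finset (Finset (Fin m))} {k : ℕ} (hk : k < m) (s : Fin k → Bool)
    (r : Bool → ℝ) {S : Finset (Fin m)} (hS : S ∈ F) :
    weight (prefixWeight s r) S = (if S ∈ restrict F (extend s false) then r false else 0)
      + (if S ∈ restrict F (extend s true) then r true else 0) := by
  simp only [mem_restrict_extend hk, hS, true_and]
  by_cases hp : ∀ (i : Fin m) (h : i.val < k), i ∈ S ↔ s ⟨i.val, h⟩ = true
  · have : weight (prefixWeight s r) S = r (decide ((⟨k, hk⟩ : Fin m) ∈ S)) := by
      rw [weight, Finset.prod_eq_single (⟨k, hk⟩ : Fin m)]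
      · simp [prefixWeight]
      · intro i _ hi
        unfold prefixWeight
        split_ifs with h1 h2 h3
        · rfl
        · exact absurd (by rw [Bool.eq_iff_iff, decide_eq_true_iff, hp i h1]) h2
        · exact absurd (Fin.ext h3) hi
        · rfl
      · simp
    rw [this]
    simp only [and_iff_right hp]
    by_cases h : (⟨k, hk⟩ : Fin m) ∈ S <;> simp [h]
  · simp only [hp, false_and, if_false, add_zero]
    push Not at hp
    obtain ⟨i, h, hi⟩ := hp
    refine Finset.prod_eq_zero (Finset.mem_univ i) ?_
    rw [prefixWeight, dif_pos h, if_neg]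
    intro h1
    rw [Bool.eq_iff_iff, decide_eq_true_iff] at h1
    tauto

/-- Stated for module-valued `f` so that it serves both the polynomials `q_S` and the masses `μ(S)`.
-/
theorem sum_weight_prefixWeight {M : Type*} [AddCommGroup M] [Module ℝ M] (hμ : ∀ S, 0 ≤ μ S)
    {k : ℕ} (hk : k < m) (s : Fin k → Bool) (r : Bool → ℝ) (f : Finset (Fin m) → M)
    (hf : ∀ S, μ S = 0 → f S = 0) :
    ∑ S, weight (prefixWeight s r) S • f S =
      r false • ∑ S ∈ restrict (support μ) (extend s false), f S
        + r true • ∑ S ∈ restrict (support μ) (extend s true), f S := by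
  rw [← Finset.sum_subset (Finset.subset_univ (support μ)) fun S _ hS => by
    rw [hf S (le_antisymm (not_lt.1 fun h => hS (by simpa [support] using h)) (hμ S)), smul_zero]]
  rw [Finset.sum_congr rfl fun S hS => by rw [weight_prefixWeight hk s r hS, add_smul],
    Finset.sum_add_distrib]
  simp only [ite_smul, zero_smul, Finset.smul_sum]
  congr 1 <;>
  · rw [← Finset.sum_filter]
    refine Finset.sum_congr ?_ fun _ _ => rfl
    ext S
    simp [restrict]

theorem isInterlacingFamily_q (hd : 1 ≤ d) (hμ : IsProbDist μ) (h : IsStronglyRayleigh μ)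
    (v : Fin m → Fin d → ℝ) : IsInterlacingFamily (support μ) (q μ v) := by
  obtain ⟨hμ0, hμ1⟩ := hμ
  refine ⟨?_, ⟨d * 2, fun S hS => ?_⟩, fun k hk s h₀ h₁ => ?_⟩
  · by_contra hne
    rw [Finset.not_nonempty_iff_eq_empty, support, Finset.filter_eq_empty_iff] at hne
    rw [Finset.sum_eq_zero fun S _ => le_antisymm (not_lt.1 (hne (Finset.mem_univ S))) (hμ0 S)]
      at hμ1
    exact zero_ne_one hμ1
  · have hS : 0 < μ S := by simpa [support] using hS
    -- The indicator of `S` alone is a product weight, so a single `q_S` is a weighted sum.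
    set θ : Fin m → Bool → ℝ := fun i b => if b = decide (i ∈ S) then 1 else 0 with hθ
    have hw : ∀ T, weight θ T = if T = S then 1 else 0 := fun T => by
      split_ifs with hT
      · subst hT
        simp [weight, hθ]
      · obtain ⟨i, hi⟩ : ∃ i, ¬(i ∈ T ↔ i ∈ S) := by
          by_contra! H
          exact hT (Finset.ext H)
        refine Finset.prod_eq_zero (Finset.mem_univ i) ?_
        simp [hθ, hi]
    have hsum : ∑ T, C (weight θ T) * q μ v T = q μ v S := by simp [hw]
    have hm : mass μ θ = μ S := by simp [mass, hw]
    have hm0 : 0 < mass μ θ := hm ▸ hS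
    have hlc : (q μ v S).leadingCoeff = μ S := by
      rw [← hsum, leadingCoeff_sum_weight_mul_q v hm0, hm]
    refine ⟨⟨?_, splits_of_aeval_ne_zero fun x hx => ?_⟩, ?_, ?_⟩
    · rw [← leadingCoeff_ne_zero, hlc]
      exact hS.ne'
    · rw [← hsum]
      refine h.aeval_sum_weight_mul_q_ne_zero hμ0 v (fun i b => ?_) hm0 hx
      simp only [hθ]
      split_ifs <;> norm_num
    · rw [← hsum, natDegree_sum_weight_mul_q v hm0]
    · rw [hlc]
      exact hS
  · have hsum : ∀ r : Bool → ℝ, ∑ S, C (weight (prefixWeight s r) S) * q μ v S =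
        C (r false) * partialSum (support μ) (q μ v) (extend s false)
          + C (r true) * partialSum (support μ) (q μ v) (extend s true) := fun r => by
      simpa only [smul_eq_C_mul, partialSum] using sum_weight_prefixWeight hμ0 hk s r (q μ v)
        fun S hS => by simp [q, hS]
    have hmass : ∀ r : Bool → ℝ, mass μ (prefixWeight s r) =
        r false * ∑ S ∈ restrict (support μ) (extend s false), μ S
          + r true * ∑ S ∈ restrict (support μ) (extend s true), μ S := fun r => by
      simpa only [smul_eq_mul, mass, mul_comm (μ _)] using
        sum_weight_prefixWeight hμ0 hk s r μ fun S hS => hS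
    have hpos : ∀ b, (restrict (support μ) (extend s b)).Nonempty →
        0 < ∑ S ∈ restrict (support μ) (extend s b), μ S := fun b hb =>
      Finset.sum_pos (fun S hS => by
        have := (Finset.mem_filter.1 hS).1
        simpa [support] using this) hb
    have hp₀ := hpos false h₀
    have hp₁ := hpos true h₁
    set r₀ : Bool → ℝ := fun b => if b then 0 else 1 with hr₀
    set r₁ : Bool → ℝ := fun b => if b then 1 else 0 with hr₁
    have hr₀n : ∀ b, 0 ≤ r₀ b := by simp [hr₀]
    have hr₁n : ∀ b, 0 ≤ r₁ b := by simp [hr₁]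
    have hm₀ : 0 < mass μ (prefixWeight s r₀) := by simpa [hmass, hr₀] using hp₀
    have hm₁ : 0 < mass μ (prefixWeight s r₁) := by simpa [hmass, hr₁] using hp₁
    have hs₀ : partialSum (support μ) (q μ v) (extend s false)
        = ∑ S, C (weight (prefixWeight s r₀) S) * q μ v S := by simp [hsum, hr₀]
    have hs₁ : partialSum (support μ) (q μ v) (extend s true)
        = ∑ S, C (weight (prefixWeight s r₁) S) * q μ v S := by simp [hsum, hr₁]
    have hdeg : d * 2 = (d * 2 - 1) + 1 := by omega
    refine haveCommonInterlacing_of_ne_zero (n := d * 2 - 1)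
      (splits_of_aeval_ne_zero fun x hx => ?_) (splits_of_aeval_ne_zero fun x hx => ?_)
      ?_ ?_ ?_ ?_ fun t ht z hz => ?_
    · rw [hs₀]
      exact h.aeval_sum_weight_mul_q_ne_zero hμ0 v (prefixWeight_nonneg s hr₀n) hm₀ hx
    · rw [hs₁]
      exact h.aeval_sum_weight_mul_q_ne_zero hμ0 v (prefixWeight_nonneg s hr₁n) hm₁ hx
    · rw [hs₀, natDegree_sum_weight_mul_q v hm₀, ← hdeg]
    · rw [hs₁, natDegree_sum_weight_mul_q v hm₁, ← hdeg]
    · rwa [hs₀, leadingCoeff_sum_weight_mul_q v hm₀]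
    · rwa [hs₁, leadingCoeff_sum_weight_mul_q v hm₁]
    -- Weighting element `k` by `t` when present and by `1` when absent produces `q_{s,0} + t
    -- q_{s,1}`.
    · set r : Bool → ℝ := fun b => if b then t else 1 with hr
      have hrn : ∀ b, 0 ≤ r b := by simp [hr, ht.le]
      have hm : 0 < mass μ (prefixWeight s r) := by
        rw [hmass]
        simp only [hr, Bool.false_eq_true, if_false, if_true]
        positivity
      have := h.aeval_sum_weight_mul_q_ne_zero hμ0 v (prefixWeight_nonneg s hrn) hm hz.ne'
      rw [hsum] at this
      simpa [hr] using this

end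

end StronglyRayleigh

theorem theorem3p3 {m d : ℕ} (hd : 1 ≤ d) (μ : Finset (Fin m) → ℝ)
    (hμ : StronglyRayleigh.IsProbDist μ)
    (hhom : StronglyRayleigh.IsHomogeneous μ)
    (hSR : StronglyRayleigh.IsStronglyRayleigh μ)
    (v : Fin m → Fin d → ℝ) :
    StronglyRayleigh.IsInterlacingFamily (StronglyRayleigh.support μ)
      (StronglyRayleigh.q μ v) :=
  StronglyRayleigh.isInterlacingFamily_q hd hμ hSR v
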